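/- For every fixed integer $k\ge 2$ there is a class $\mathcal C$ of inputs $(G,\alpha,\beta)$, where $G$ is a finite connected $k$-regular graph and $\alpha,\beta$ are maximal independent sets of $G$, with unboundedly many nodes, on which finding a reconfiguration schedule of constant length with independent $4$-dominating intermediate sets takes $\Theta(\log^* n)$ rounds of the deterministic LOCAL model, $n$ being the number of nodes of $G$. Here a schedule of length $\ell$ is a sequence $S_0=\alpha,S_1,\dots,S_\ell=\beta$ of sets of nodes such that for $0<i<\ell$ the set $S_i$ is independent and every node is at distance at most $4$ from $S_i$, and such that for $0<i\le\ell$ the symmetric difference of $S_{i-1}$ and $S_i$ is independent. In the LOCAL model the nodes have distinct identifiers from $\{0,\dots,n^d-1\}$ for a fixed $d\ge1$; each node initially knows $n$, its identifier and whether it is in $\alpha$ and in $\beta$; in each synchronous round it exchanges messages of arbitrary size with its neighbors; at the end it outputs for which $i$ it is in $S_i$. Precisely: (1) There is $\ell_0$ such that for every $\ell\ge\ell_0$ and every $d\ge1$ there are a constant $C$ and an algorithm that finds a schedule of length $\ell$ within $C\log^*n$ rounds on every $n$-node input in $\mathcal C$ for every assignment of identifiers. (2) For every $\ell$ and $d\ge1$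 there are constants $c>0$ and $n_0$ such that, for every $n\ge n_0$ that is the number of nodes of some input in $\mathcal C$, every algorithm that finds a schedule of length $\ell$ within $T$ rounds on all $n$-node inputs in $\mathcal C$ and for all assignments of identifiers satisfies $T\ge c\log^*n$. -/

import Mathlib

open scoped symmDiff

/-- The iterated logarithm `log* x`: the least number of times `log₂` has to be applied to `x`
until the value is at most `1`. -/
noncomputable def logStar (x : ℝ) : ℕ :=
  sInf {i : ℕ | (Real.logb 2)^[i] x ≤ 1}

/-- An `(x, y)`-ruling set `U` of `G`: any two distinct nodes of `U` are at distance at least `x`,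
and every node outside `U` is at distance at most `y` from some node of `U`.
A `(2, 4)`-ruling set is an independent `4`-dominating set. -/
def IsRulingSet {V : Type*} (G : SimpleGraph V) (x y : ℕ) (U : Set V) : Prop :=
  (∀ u ∈ U, ∀ v ∈ U, u ≠ v → (x : ℕ∞) ≤ G.edist u v) ∧
    ∀ v, v ∉ U → ∃ u ∈ U, G.edist v u ≤ (y : ℕ∞)

/-- `S = (S₀, …, S_ℓ)` is an `(α, β, P)`-reconfiguration schedule of length `ℓ` in `G`. -/
structure IsReconfigurationSchedule {V : Type*} (G : SimpleGraph V) (P : Set V → Prop)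
    (α β : Set V) (ℓ : ℕ) (S : Fin (ℓ + 1) → Set V) : Prop where
  first : S 0 = α
  last : S (Fin.last ℓ) = β
  property : ∀ i, 0 < i → i < Fin.last ℓ → P (S i)
  step : ∀ i : Fin ℓ, G.IsIndepSet (S i.succ ∆ S i.castSucc)

/-- An input of the MIS-reconfiguration problem: a finite graph with two maximal independent
sets. -/
structure ReconfigurationInput where
  V : Type
  [fintypeV : Fintype V]
  graph : SimpleGraph V
  α : Set V
  β : Set V
  maximal_α : Maximal graph.IsIndepSet α
  maximal_β : Maximal graph.IsIndepSet β

attribute [instance] ReconfigurationInput.fintypeV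

/-- A deterministic algorithm of the LOCAL model, for nodes with local input in `I` and local
output in `O`. All nodes run the same algorithm. There is no restriction on the size of the
messages and of the states, or on the local computations. -/
structure LocalAlgorithm (I O : Type) where
  /-- the local states -/
  State : Type
  /-- the messages -/
  Message : Type
  /-- the initial state, given the number of nodes, the identifier and the input of the node -/
  init : ℕ → ℕ → I → State
  /-- the message sent, in a given state, to the neighbor with a given identifier -/
  send : State → ℕ → Message
  /-- the new state, given the old one and the received messages with their senders -/
  receive : State → Set (ℕ × Message) → State
  /-- the output in a given state -/
  output : State → O

namespace LocalAlgorithm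

variable {I O : Type} (A : LocalAlgorithm I O) {V : Type} [Fintype V] (G : SimpleGraph V)
  (ident : V → ℕ) (input : V → I)

/-- The state of each node of the network `G` after `t` synchronous rounds. In each round every
node sends a message to each neighbor and receives the messages of all its neighbors. -/
def stateAfter : ℕ → V → A.State
  | 0, v => A.init (Fintype.card V) (ident v) (input v)
  | t + 1, v => A.receive (stateAfter t v)
      {p | ∃ u, G.Adj v u ∧ p = (ident u, A.send (stateAfter t u) (ident v))}

/-- The output of each node of the network `G` after `t` rounds. -/
def outputAfter (t : ℕ) (v : V) : O :=
  A.output (A.stateAfter G ident input t v)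

end LocalAlgorithm

/-- The algorithm `A` finds, within `T` rounds, a reconfiguration schedule of length `ℓ` with
independent `4`-dominating intermediate sets, on all inputs in `𝒞` with `n` nodes and for all
assignments of distinct identifiers in `{0, …, n ^ d - 1}`. Each node initially knows `n`, its own
identifier and whether it belongs to `α` and to `β`, and it outputs the set of those indices `i`
for which it belongs to `S i`. -/
def FindsSchedule {ℓ : ℕ} (A : LocalAlgorithm (Prop × Prop) (Set (Fin (ℓ + 1))))
    (𝒞 : Set ReconfigurationInput) (d n T : ℕ) : Prop :=
  ∀ X ∈ 𝒞, Fintype.card X.V = n →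
    ∀ ident : X.V → ℕ, Function.Injective ident → (∀ v, ident v < n ^ d) →
      IsReconfigurationSchedule X.graph (IsRulingSet X.graph 2 4) X.α X.β ℓ
        (fun i => {v | i ∈ A.outputAfter X.graph ident (fun u => (u ∈ X.α, u ∈ X.β)) T v})

/-- The set of the numbers of nodes of the inputs in `𝒞`. -/
def inputSizes (𝒞 : Set ReconfigurationInput) : Set ℕ :=
  {n | ∃ X ∈ 𝒞, Fintype.card X.V = n}

/-! The class consists of the cyclic chains `blockCycle` with `s = k - 1`, where `α` and `β` are the
two sides of the bipartition.

Upper bound. Suppose that `α` is colored with `M` colors so that nodes of `α` within distance 4 get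
distinct colors. Removing the color classes of `α` one by one, and inserting a node of `β` once its
last neighbor in `α` is gone, takes `2 * M` steps. Each node stays dominated, because at most one
class is in transition at a time and no two of its nodes are close (`isRulingSet_colorSchedule`).
Balls of radius 4 have at most `18 * s` nodes, so iterating `exists_recoloring` in the manner of
Linial and Cole–Vishkin turns the identifiers into such a coloring, with `M` independent of `n`, in
`O(log* n)` phases of four rounds each.

Lower bound. Nine consecutive blocks cannot all produce the same output: in the middle one, no node
of `β` could ever enter (`false_of_blocks_alike`). By locality the output of a block is a function
of the identifiers in a window of `2 * T + 1` blocks. Collecting eight consecutive outputs therefore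
gives a finite coloring of increasing sequences that distinguishes each sequence from its shift. By
Linial's argument (`le_iterate_of_shift_coloring`), the number of blocks is then at most a tower of
exponentials of height `2 * T + O(1)`. -/

/-! ### The graph: regularity, connectivity and balls -/

/-- The cyclic chain of `m` blocks. Each block is a complete bipartite graph with two layers of
`s` nodes, and a perfect matching joins the layer `true` of a block to the layer `false` of the
next one. -/
def blockCycle (m s : ℕ) : SimpleGraph (ZMod m × Bool × Fin s) where
  Adj u v :=
    (u.2.1 = false ∧ v.2.1 = true ∧ (v.1 = u.1 ∨ (u.1 = v.1 + 1 ∧ u.2.2 = v.2.2))) ∨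
    (v.2.1 = false ∧ u.2.1 = true ∧ (u.1 = v.1 ∨ (v.1 = u.1 + 1 ∧ v.2.2 = u.2.2)))
  symm := ⟨fun _ _ h => h.symm⟩
  loopless := ⟨fun v h => by
    rcases h with h | h <;> simp [h.1] at h⟩

namespace blockCycle

variable {m s : ℕ}

/-- The nodes in the layers `b`. -/
def side (m s : ℕ) (b : Bool) : Set (ZMod m × Bool × Fin s) := {v | v.2.1 = b}

@[simp] lemma mem_side {b : Bool} {v : ZMod m × Bool × Fin s} : v ∈ side m s b ↔ v.2.1 = b :=
  Iff.rfl

lemma adj_false_true {i j : ZMod m} {x y : Fin s} :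
    (blockCycle m s).Adj (i, false, x) (j, true, y) ↔ j = i ∨ (i = j + 1 ∧ x = y) := by
  simp [blockCycle]

lemma adj_true_false {i j : ZMod m} {x y : Fin s} :
    (blockCycle m s).Adj (j, true, y) (i, false, x) ↔ j = i ∨ (i = j + 1 ∧ x = y) := by
  rw [SimpleGraph.adj_comm, adj_false_true]

lemma not_adj_same {i j : ZMod m} {x y : Fin s} (b : Bool) :
    ¬ (blockCycle m s).Adj (i, b, x) (j, b, y) := by
  cases b <;> simp [blockCycle]

lemma side_ne_of_adj {u v : ZMod m × Bool × Fin s} (h : (blockCycle m s).Adj u v) :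
    u.2.1 ≠ v.2.1 := by
  rcases h with h | h <;> simp [h.1, h.2.1]

lemma isIndepSet_of_subset_side {b : Bool} {U : Set (ZMod m × Bool × Fin s)}
    (h : U ⊆ side m s b) : (blockCycle m s).IsIndepSet U := by
  intro u hu v hv _ hadj
  exact side_ne_of_adj hadj ((h hu).trans (h hv).symm)

lemma exists_adj_other_side (v : ZMod m × Bool × Fin s) :
    ∃ w, (blockCycle m s).Adj v w ∧ w.2.1 = !v.2.1 := by
  obtain ⟨i, b, x⟩ := v
  cases b
  · exact ⟨(i, true, x), adj_false_true.2 (Or.inl rfl), rfl⟩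
  · exact ⟨(i, false, x), adj_true_false.2 (Or.inl rfl), rfl⟩

lemma maximal_side (b : Bool) : Maximal (blockCycle m s).IsIndepSet (side m s b) := by
  refine ⟨isIndepSet_of_subset_side subset_rfl, fun U hU hsub v hv => ?_⟩
  by_contra hvb
  obtain ⟨w, hadj, hw⟩ := exists_adj_other_side v
  have hwb : w ∈ side m s b := by
    rw [mem_side, hw]
    rw [mem_side] at hvb
    cases b <;> simpa using hvb
  exact hU hv (hsub hwb) hadj.ne hadj

lemma ncard_neighborSet (hm : 3 ≤ m) (v : ZMod m × Bool × Fin s) :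
    ((blockCycle m s).neighborSet v).ncard = s + 1 := by
  have : Fact (1 < m) := ⟨by omega⟩
  obtain ⟨i, b, x⟩ := v
  have key : ∀ (c : Bool) (j : ZMod m), j ≠ i →
      (insert (j, c, x) ((fun y : Fin s => ((i, c, y) : ZMod m × Bool × Fin s)) '' Set.univ)).ncard
        = s + 1 := by
    intro c j hj
    rw [Set.ncard_insert_of_notMem _ (Set.toFinite _), Set.ncard_image_of_injective]
    · simp
    · intro y z h
      simpa using h
    · rintro ⟨y, -, h⟩
      exact hj (Prod.ext_iff.1 h).1.symm
  cases b
  · rw [← key true (i - 1) (by simp)]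
    congr 1
    ext ⟨j, c, y⟩
    cases c
    · simp [not_adj_same]
    · simp only [SimpleGraph.mem_neighborSet, adj_false_true, Set.mem_insert_iff, Prod.mk.injEq,
        Set.image_univ, Set.mem_range, true_and]
      constructor
      · rintro (h | ⟨h, h'⟩)
        · exact Or.inr ⟨y, h.symm, rfl⟩
        · exact Or.inl ⟨by rw [h]; ring, h'.symm⟩
      · rintro (⟨h, h'⟩ | ⟨z, h, -⟩)
        · exact Or.inr ⟨by rw [h]; ring, h'.symm⟩
        · exact Or.inl h.symm
  · rw [← key false (i + 1) (by simp)]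
    congr 1
    ext ⟨j, c, y⟩
    cases c
    · simp only [SimpleGraph.mem_neighborSet, adj_true_false, Set.mem_insert_iff, Prod.mk.injEq,
        Set.image_univ, Set.mem_range, true_and]
      constructor
      · rintro (h | ⟨h, h'⟩)
        · exact Or.inr ⟨y, h, rfl⟩
        · exact Or.inl ⟨h, h'⟩
      · rintro (⟨h, h'⟩ | ⟨z, h, -⟩)
        · exact Or.inr ⟨h, h'⟩
        · exact Or.inl h
    · simp [not_adj_same]

lemma connected [NeZero m] [NeZero s] : (blockCycle m s).Connected := by
  have hblock : ∀ (i : ZMod m) (b : Bool) (x : Fin s),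
      (blockCycle m s).Reachable (i, false, 0) (i, b, x) := by
    intro i b x
    have h1 : ∀ y, (blockCycle m s).Reachable (i, false, 0) (i, true, y) := fun y =>
      (adj_false_true.2 (Or.inl rfl)).reachable
    cases b
    · exact (h1 0).trans (adj_true_false.2 (Or.inl rfl)).reachable
    · exact h1 x
  have hzero : ∀ n : ℕ, (blockCycle m s).Reachable (0, false, 0) ((n : ZMod m), false, 0) := by
    intro n
    induction n with
    | zero => simp
    | succ n ih =>
      refine (ih.trans (hblock n true 0)).trans (SimpleGraph.Adj.reachable ?_)
      exact adj_true_false.2 (Or.inr ⟨by push_cast; rfl, rfl⟩)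
  have hall : ∀ v, (blockCycle m s).Reachable (0, false, 0) v := by
    rintro ⟨i, b, x⟩
    have := hzero i.val
    rw [ZMod.natCast_zmod_val] at this
    exact this.trans (hblock i b x)
  have : Nonempty (ZMod m × Bool × Fin s) := ⟨(0, false, 0)⟩
  exact ⟨fun u v => (hall u).symm.trans (hall v)⟩

/-- Lifting block indices from `ZMod m` to `ℤ` lets distances between blocks be measured without
treating wrap-around separately. -/
lemma exists_block_of_adj {u v : ZMod m × Bool × Fin s} (h : (blockCycle m s).Adj u v) {i : ℤ}
    (hi : u.1 = i) : ∃ j : ℤ, |j - i| ≤ 1 ∧ v.1 = j := by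
  rcases h with ⟨-, -, h | ⟨h, -⟩⟩ | ⟨-, -, h | ⟨h, -⟩⟩
  · exact ⟨i, by simp, h.trans hi⟩
  · refine ⟨i - 1, by simp, ?_⟩
    push_cast
    rw [← hi, h]
    ring
  · exact ⟨i, by simp, h.symm.trans hi⟩
  · exact ⟨i + 1, by simp, by push_cast; rw [h, hi]⟩

lemma exists_block_of_walk {u v : ZMod m × Bool × Fin s} (p : (blockCycle m s).Walk u v) :
    ∀ {i : ℤ}, u.1 = i → ∃ j : ℤ, |j - i| ≤ p.length ∧ v.1 = j := by
  induction p with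
  | nil => exact fun {i} hi => ⟨i, by simp, hi⟩
  | cons h p ih =>
    intro i hi
    obtain ⟨j, hj, hj'⟩ := exists_block_of_adj h hi
    obtain ⟨l, hl, hl'⟩ := ih hj'
    refine ⟨l, ?_, hl'⟩
    rw [SimpleGraph.Walk.length_cons]
    push_cast
    have := abs_sub_le l j i
    linarith

lemma exists_walk_of_edist_le {V : Type*} {G : SimpleGraph V} {u v : V} {r : ℕ}
    (h : G.edist u v ≤ r) : ∃ p : G.Walk u v, p.length ≤ r := by
  have hne : G.edist u v ≠ ⊤ := fun h' => by simp [h'] at h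
  obtain ⟨p, hp⟩ := SimpleGraph.exists_walk_of_edist_ne_top hne
  exact ⟨p, by rw [← hp] at h; exact_mod_cast h⟩

/-- The nodes at distance at most `r` from `v`. -/
def ball {V : Type*} (G : SimpleGraph V) (r : ℕ) (v : V) : Set V :=
  {u | ∃ p : G.Walk v u, p.length ≤ r}

lemma mem_ball_comm {V : Type*} {G : SimpleGraph V} {r : ℕ} {u v : V} :
    u ∈ ball G r v ↔ v ∈ ball G r u :=
  ⟨fun ⟨p, hp⟩ => ⟨p.reverse, by simpa⟩, fun ⟨p, hp⟩ => ⟨p.reverse, by simpa⟩⟩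

lemma mem_ball_succ {V : Type*} {G : SimpleGraph V} {r : ℕ} {u v : V} :
    u ∈ ball G (r + 1) v ↔ u ∈ ball G r v ∨ ∃ w, G.Adj v w ∧ u ∈ ball G r w := by
  constructor
  · rintro ⟨p, hp⟩
    cases p with
    | nil => exact Or.inl ⟨.nil, by simp⟩
    | cons h p =>
      exact Or.inr ⟨_, h, p, by simpa using hp⟩
  · rintro (⟨p, hp⟩ | ⟨w, h, p, hp⟩)
    · exact ⟨p, by omega⟩
    · exact ⟨.cons h p, by simpa using hp⟩

lemma mem_ball_zero {V : Type*} {G : SimpleGraph V} {u v : V} : u ∈ ball G 0 v ↔ u = v := by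
  constructor
  · rintro ⟨p, hp⟩
    exact (SimpleGraph.Walk.eq_of_length_eq_zero (Nat.le_zero.1 hp)).symm
  · rintro rfl
    exact ⟨.nil, by simp⟩

/-- A walk of length 4 stays within nine consecutive blocks, and each block has `2 * s` nodes. -/
lemma ncard_ball_four_le [NeZero m] (v : ZMod m × Bool × Fin s) :
    (ball (blockCycle m s) 4 v).ncard ≤ 18 * s := by
  have hv : v.1 = ((v.1.val : ℤ) : ZMod m) := by simp
  set f : ℤ × Bool × Fin s → ZMod m × Bool × Fin s :=
    fun q => (((v.1.val + q.1 : ℤ) : ZMod m), q.2) with hf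
  have hsub : ball (blockCycle m s) 4 v ⊆
      (((Finset.Icc (-4 : ℤ) 4 ×ˢ Finset.univ).image f : Finset _) : Set _) := by
    rintro u ⟨p, hp⟩
    obtain ⟨j, hj, hj'⟩ := exists_block_of_walk p hv
    have h4 : |j - (v.1.val : ℤ)| ≤ 4 := hj.trans (by exact_mod_cast hp)
    rw [abs_le] at h4
    simp only [Finset.coe_image, Set.mem_image]
    refine ⟨(j - v.1.val, u.2), Finset.mem_coe.2 (Finset.mem_product.2
      ⟨Finset.mem_Icc.2 ⟨by dsimp only; omega, by dsimp only; omega⟩, Finset.mem_univ _⟩), ?_⟩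
    simp only [hf]
    ext1
    · simpa using hj'.symm
    · rfl
  refine (Set.ncard_le_ncard hsub (Finset.finite_toSet _)).trans ?_
  rw [Set.ncard_coe_finset]
  refine Finset.card_image_le.trans ?_
  rw [Finset.card_product]
  simp
  omega

end blockCycle

/-! ### Iterated logarithms and towers of exponentials -/

section LogStar

open Real

lemma nat_le_iterate_two_rpow (t : ℕ) : (t : ℝ) + 1 ≤ (fun y : ℝ => 2 ^ y)^[t] 1 := by
  induction t with
  | zero => simp
  | succ t ih =>
    rw [Function.iterate_succ_apply']
    have h1 : (2 : ℝ) ^ ((t : ℝ) + 1) ≤ 2 ^ ((fun y : ℝ => 2 ^ y)^[t] 1) :=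
      rpow_le_rpow_of_exponent_le (by norm_num) ih
    have h2 : ((t : ℝ) + 1) + 1 ≤ (2 : ℝ) ^ ((t : ℝ) + 1) := by
      have : t + 1 + 1 ≤ 2 ^ (t + 1) := Nat.lt_two_pow_self
      have h3 : (((t + 1 + 1 : ℕ)) : ℝ) ≤ ((2 ^ (t + 1) : ℕ) : ℝ) := by exact_mod_cast this
      push_cast at h3
      rw [show ((t : ℝ) + 1) = ((t + 1 : ℕ) : ℝ) by push_cast; ring, rpow_natCast]
      push_cast
      exact h3
    push_cast
    exact h2.trans h1

lemma exists_iterate_logb_le_one (t : ℕ) :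
    ∀ x : ℝ, x ≤ (fun y : ℝ => 2 ^ y)^[t] 1 → ∃ i ≤ t, (logb 2)^[i] x ≤ 1 := by
  induction t with
  | zero => exact fun x hx => ⟨0, le_rfl, hx⟩
  | succ t ih =>
    intro x hx
    rcases le_or_gt x 1 with h1 | h1
    · exact ⟨0, by omega, h1⟩
    · rw [Function.iterate_succ_apply'] at hx
      obtain ⟨i, hi, hi'⟩ := ih (logb 2 x)
        ((logb_le_iff_le_rpow (by norm_num) (by linarith)).2 hx)
      exact ⟨i + 1, by omega, by rwa [Function.iterate_succ_apply]⟩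

lemma logStar_le_of_le_iterate {t : ℕ} {x : ℝ} (hx : x ≤ (fun y : ℝ => 2 ^ y)^[t] 1) :
    logStar x ≤ t := by
  obtain ⟨i, hi, hi'⟩ := exists_iterate_logb_le_one t x hx
  exact (Nat.sInf_le hi').trans hi

lemma iterate_logStar_le_one (x : ℝ) : (logb 2)^[logStar x] x ≤ 1 := by
  obtain ⟨t, ht⟩ := exists_nat_ge x
  obtain ⟨i, -, hi⟩ := exists_iterate_logb_le_one t x
    (by linarith [nat_le_iterate_two_rpow t])
  exact Nat.sInf_mem (s := {i : ℕ | (logb 2)^[i] x ≤ 1}) ⟨i, hi⟩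

lemma one_le_logStar {x : ℝ} (hx : 1 < x) : 1 ≤ logStar x := by
  by_contra h
  have h0 : logStar x = 0 := by omega
  have := iterate_logStar_le_one x
  rw [h0] at this
  simp at this
  linarith

/-- Two applications of `f` do at least as well as one logarithm, until the threshold `M` is
reached. -/
lemma exists_iterate_le_of_logb {f : ℕ → ℕ} {M : ℕ} (hM1 : 1 ≤ M)
    (hM : ∀ m ≥ M, (f (f m) : ℝ) ≤ logb 2 m) (i : ℕ) :
    ∀ (x : ℝ) (m : ℕ), (m : ℝ) ≤ x → (logb 2)^[i] x ≤ 1 → ∃ J ≤ 2 * i, f^[J] m ≤ M := by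
  induction i with
  | zero =>
    intro x m hm hx
    refine ⟨0, le_rfl, ?_⟩
    have : (m : ℝ) ≤ 1 := hm.trans hx
    have : m ≤ 1 := by exact_mod_cast this
    exact this.trans hM1
  | succ i ih =>
    intro x m hm hx
    rcases le_or_gt m M with h | h
    · exact ⟨0, by omega, h⟩
    have hm0 : (0 : ℝ) < m := by exact_mod_cast (by omega : 0 < m)
    obtain ⟨J, hJ, hJ'⟩ := ih (logb 2 x) (f (f m))
      ((hM m h.le).trans (logb_le_logb_of_le (by norm_num) hm0 hm))
      (by rwa [Function.iterate_succ_apply] at hx)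
    exact ⟨J + 2, by omega, hJ'⟩

/-- For large `n`, the first two applications of `f` lead from `n ^ d` to at most `d * logb 2 n ≤
n`, so the exponent `d` costs only two extra iterations. -/
lemma exists_iterate_le_mul_logStar {f : ℕ → ℕ} {M : ℕ} (hM1 : 1 ≤ M)
    (hM : ∀ m ≥ M, (f (f m) : ℝ) ≤ logb 2 m) (d : ℕ) :
    ∃ C : ℕ, ∀ n : ℕ, 2 ≤ n → ∃ J ≤ C * logStar n, f^[J] (n ^ d) ≤ M := by
  have hev : ∀ᶠ n : ℕ in Filter.atTop, (d : ℝ) * logb 2 n ≤ n := by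
    have h := (isLittleO_log_id_atTop.comp_tendsto tendsto_natCast_atTop_atTop).bound
      (show (0 : ℝ) < log 2 / (d + 1) by have := log_pos one_lt_two; positivity)
    filter_upwards [h, Filter.eventually_ge_atTop 1] with n hn hn1
    have hlog : 0 ≤ log (n : ℝ) := log_nonneg (by exact_mod_cast hn1)
    have h2 := log_pos one_lt_two
    simp only [Function.comp_apply, id_eq, norm_eq_abs, abs_of_nonneg hlog, Nat.abs_cast] at hn
    rw [logb, ← mul_div_assoc, div_le_iff₀ h2]
    rw [div_mul_eq_mul_div, le_div_iff₀ (by positivity)] at hn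
    nlinarith
  obtain ⟨N, hN⟩ := Filter.eventually_atTop.1 hev
  have hex : ∀ n : ℕ, ∃ J, f^[J] (n ^ d) ≤ M := by
    intro n
    obtain ⟨J, -, hJ⟩ := exists_iterate_le_of_logb hM1 hM _ ((n ^ d : ℕ) : ℝ) (n ^ d) le_rfl
      (iterate_logStar_le_one _)
    exact ⟨J, hJ⟩
  choose J hJ using hex
  -- The sum covers the finitely many `n < N`; the 4 covers `2 * logStar n + 2` for the others.
  refine ⟨4 + ∑ n ∈ Finset.range N, J n, fun n hn => ?_⟩
  have hls : 1 ≤ logStar (n : ℝ) := one_le_logStar (by exact_mod_cast (by omega : 1 < n))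
  rcases lt_or_ge n N with hlt | hge
  · refine ⟨J n, ?_, hJ n⟩
    have : J n ≤ ∑ n ∈ Finset.range N, J n :=
      Finset.single_le_sum (f := J) (fun _ _ => Nat.zero_le _) (Finset.mem_range.2 hlt)
    calc J n ≤ (4 + ∑ n ∈ Finset.range N, J n) * 1 := by omega
      _ ≤ _ := Nat.mul_le_mul_left _ hls
  · rcases le_or_gt (n ^ d) M with h | h
    · exact ⟨0, Nat.zero_le _, h⟩
    have hstep : (f (f (n ^ d)) : ℝ) ≤ n := by
      refine (hM _ h.le).trans ?_
      push_cast
      rw [← rpow_natCast, logb_rpow_eq_mul_logb_of_pos (by exact_mod_cast (by omega : 0 < n))]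
      exact hN n hge
    obtain ⟨i, hi, hi'⟩ := exists_iterate_le_of_logb hM1 hM _ _ _ hstep (iterate_logStar_le_one _)
    refine ⟨i + 2, ?_, hi'⟩
    calc i + 2 ≤ 4 * logStar (n : ℝ) := by omega
      _ ≤ _ := Nat.mul_le_mul_right _ (by omega)

end LogStar

/-! ### Color reduction -/

section ColorReduction

/-- The number of colors left after one step of color reduction from `m` colors, if at
most `Δ` colors occur in each neighborhood. -/
def paletteSize (Δ m : ℕ) : ℕ := (Nat.clog 2 m * 2 + 1) ^ Δ

lemma natClog_le_log {y : ℕ} (hy : 1 ≤ y) :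
    (Nat.clog 2 y : ℝ) ≤ Real.log y / Real.log 2 + 1 := by
  have h2 := Real.log_pos one_lt_two
  rcases hy.eq_or_lt with rfl | hy
  · simp
  · have h := Nat.pow_pred_clog_lt_self (b := 2) (by norm_num) hy
    have h1 : ((2 ^ (Nat.clog 2 y).pred : ℕ) : ℝ) ≤ y := by exact_mod_cast h.le
    have h3 := Real.log_le_log (by positivity) h1
    push_cast at h3
    rw [Real.log_pow, ← le_div_iff₀ h2] at h3
    have hpos := Nat.clog_pos (b := 2) (by norm_num) hy
    have h4 : ((Nat.clog 2 y).pred : ℝ) + 1 = Nat.clog 2 y := by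
      exact_mod_cast Nat.succ_pred_eq_of_pos hpos
    linarith

/-- A single reduction step leaves a power of `log m`, which may exceed `log m`; a second step
leaves a power of `log log m`, which is eventually smaller. -/
lemma exists_paletteSize_le_logb (Δ : ℕ) :
    ∃ M : ℕ, 1 ≤ M ∧ ∀ m ≥ M, (paletteSize Δ (paletteSize Δ m) : ℝ) ≤ Real.logb 2 m := by
  have h2 := Real.log_pos one_lt_two
  set K : ℝ := 2 * Δ * (1 / Real.log 2 + 1) + 1 with hK
  have hK0 : 0 < K := by positivity
  have hlin : Filter.Tendsto (fun b : ℕ => ((b * 2 + 1 : ℕ) : ℝ)) Filter.atTop Filter.atTop := by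
    refine tendsto_natCast_atTop_atTop.comp (Filter.tendsto_atTop_mono (fun b => ?_)
      Filter.tendsto_id)
    simp; omega
  have hev := ((Real.isLittleO_pow_log_id_atTop (n := Δ)).comp_tendsto hlin).bound
    -- The factor 6 is chosen for `(2 * b + 1) / 6 ≤ b - 1`, valid for `b ≥ 2`; the bound `b - 1` is
    -- needed because `Nat.clog` rounds the logarithm up.
    (show (0 : ℝ) < 1 / (6 * K ^ Δ) by positivity)
  have hev2 : ∀ᶠ b : ℕ in Filter.atTop,
      ((Nat.clog 2 ((b * 2 + 1) ^ Δ) * 2 + 1 : ℕ) : ℝ) ^ Δ ≤ b - 1 := by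
    filter_upwards [hev, Filter.eventually_ge_atTop 2] with b hb hb2
    set y : ℕ := b * 2 + 1 with hy
    have hb2' : (2 : ℝ) ≤ b := by exact_mod_cast hb2
    have hlog : 1 ≤ Real.log y := by
      rw [Real.le_log_iff_exp_le (by positivity)]
      have := Real.exp_one_lt_d9
      have : (5 : ℝ) ≤ y := by exact_mod_cast (by omega : 5 ≤ y)
      linarith
    have hlog0 : 0 ≤ Real.log y := by linarith
    simp only [Function.comp_apply, id_eq, Real.norm_eq_abs, abs_pow,
      Nat.abs_cast] at hb
    rw [← hy, abs_of_nonneg hlog0] at hb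
    have hc : (Nat.clog 2 (y ^ Δ) : ℝ) ≤ Δ * Nat.clog 2 y := by
      have : Nat.clog 2 (y ^ Δ) ≤ Δ * Nat.clog 2 y := by
        apply Nat.clog_le_of_le_pow
        rw [mul_comm, pow_mul]
        exact Nat.pow_le_pow_left (Nat.le_pow_clog (by norm_num) y) Δ
      exact_mod_cast this
    have hc2 := natClog_le_log (y := y) (by omega)
    have hle : ((Nat.clog 2 (y ^ Δ) * 2 + 1 : ℕ) : ℝ) ≤ K * Real.log y := by
      push_cast
      have h3 : (Δ : ℝ) * Nat.clog 2 y ≤ Δ * ((1 / Real.log 2 + 1) * Real.log y) := by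
        refine mul_le_mul_of_nonneg_left (hc2.trans ?_) (by positivity)
        have : Real.log y / Real.log 2 = 1 / Real.log 2 * Real.log y := by ring
        rw [this]
        linarith
      rw [hK]
      linarith
    calc ((Nat.clog 2 (y ^ Δ) * 2 + 1 : ℕ) : ℝ) ^ Δ ≤ (K * Real.log y) ^ Δ :=
          pow_le_pow_left₀ (by positivity) hle Δ
      _ = K ^ Δ * Real.log y ^ Δ := mul_pow _ _ _
      _ ≤ K ^ Δ * (1 / (6 * K ^ Δ) * y) := mul_le_mul_of_nonneg_left hb (by positivity)
      _ = y / 6 := by field_simp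
      _ ≤ b - 1 := by rw [hy]; push_cast; linarith
  obtain ⟨B, hB⟩ := Filter.eventually_atTop.1 hev2
  have hB0 := Nat.two_pow_pos B
  refine ⟨2 ^ B + 2, by omega, fun m hm => ?_⟩
  have hm1 : 1 < m := by omega
  have hBm : B ≤ Nat.clog 2 m := by
    refine ((Nat.lt_clog_iff_pow_lt (by norm_num)).2 ?_).le
    omega
  have h := hB _ hBm
  have h3 := Nat.pow_pred_clog_lt_self (b := 2) (by norm_num) hm1
  have hpos := Nat.clog_pos (b := 2) (by norm_num) hm1
  have h4 : ((Nat.clog 2 m).pred : ℝ) + 1 = Nat.clog 2 m := by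
    exact_mod_cast Nat.succ_pred_eq_of_pos hpos
  have h5 : ((Nat.clog 2 m).pred : ℝ) ≤ Real.logb 2 m := by
    rw [Real.le_logb_iff_rpow_le (by norm_num) (by positivity), Real.rpow_natCast]
    exact_mod_cast h3.le
  have h6 : (paletteSize Δ (paletteSize Δ m) : ℝ) =
      ((Nat.clog 2 ((Nat.clog 2 m * 2 + 1) ^ Δ) * 2 + 1 : ℕ) : ℝ) ^ Δ := by
    simp [paletteSize]
  rw [h6]
  linarith

/-- A set of at most `Δ` elements can be listed by a function `Fin Δ → Option β`, with `none` as
padding; these functions are then numbered. -/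
lemma exists_injOn_small_sets (β : Type) [Fintype β] (Δ : ℕ) :
    ∃ code : Set β → ℕ, (∀ F, code F < (Fintype.card β + 1) ^ Δ) ∧
      ∀ F F' : Set β, F.ncard ≤ Δ → F'.ncard ≤ Δ → code F = code F' → F = F' := by
  classical
  let dec : (Fin Δ → Option β) → Set β := fun g => {x | ∃ i, g i = some x}
  have hdec : ∀ F : Set β, F.ncard ≤ Δ → ∃ g, dec g = F := by
    intro F hF
    have hcard : Fintype.card F ≤ Δ := by rwa [← Nat.card_eq_fintype_card, Nat.card_coe_set_eq]
    let e := Fintype.equivFin F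
    refine ⟨fun i => if h : i.val < Fintype.card F then some (e.symm ⟨i, h⟩ : β) else none, ?_⟩
    ext x
    simp only [dec, Set.mem_ofPred_eq]
    constructor
    · rintro ⟨i, hi⟩
      split_ifs at hi with h
      rw [← Option.some.inj hi]
      exact (e.symm ⟨i, h⟩).2
    · intro hx
      refine ⟨⟨(e ⟨x, hx⟩).val, (e ⟨x, hx⟩).2.trans_le hcard⟩, ?_⟩
      rw [dif_pos (e ⟨x, hx⟩).2]
      simp
  have hc : Fintype.card (Fin Δ → Option β) = (Fintype.card β + 1) ^ Δ := by simp
  refine ⟨fun F => (Fintype.equivFinOfCardEq hc (Function.invFun dec F)).val, fun F => Fin.isLt _,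
    fun F F' hF hF' h => ?_⟩
  have h1 : Function.invFun dec F = Function.invFun dec F' := by
    simpa [Fin.val_inj] using h
  rw [← Function.invFun_eq (hdec F hF), h1, Function.invFun_eq (hdec F' hF')]

/-- The first position at which the binary expansions of `c` and `e` differ. -/
noncomputable def firstDiff (c e : ℕ) : ℕ := sInf {i | c.testBit i ≠ e.testBit i}

lemma testBit_firstDiff {c e : ℕ} (h : c ≠ e) :
    c.testBit (firstDiff c e) ≠ e.testBit (firstDiff c e) :=
  Nat.sInf_mem (s := {i | c.testBit i ≠ e.testBit i}) (Nat.exists_testBit_ne_of_ne h)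

lemma firstDiff_lt {b c e : ℕ} (h : c ≠ e) (hc : c < 2 ^ b) (he : e < 2 ^ b) :
    firstDiff c e < b := by
  by_contra hb
  push Not at hb
  have hp : 2 ^ b ≤ 2 ^ firstDiff c e := Nat.pow_le_pow_right (by norm_num) hb
  apply testBit_firstDiff h
  rw [Nat.testBit_lt_two_pow (hc.trans_le hp), Nat.testBit_lt_two_pow (he.trans_le hp)]

/-- One step of color reduction: the new color of a node is determined by its color `c` and the
set `K` of the colors in its neighborhood. -/
lemma exists_recoloring (Δ m : ℕ) :
    ∃ φ : ℕ → Set ℕ → ℕ, (∀ c K, φ c K < paletteSize Δ m) ∧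
      ∀ c c' K K', c ≠ c' → K ⊆ Set.Iio m → K' ⊆ Set.Iio m → K.ncard ≤ Δ → K'.ncard ≤ Δ →
        c ∈ K → c ∈ K' → c' ∈ K → c' ∈ K' → φ c K ≠ φ c' K' := by
  set b := Nat.clog 2 m with hb
  have hmb : m ≤ 2 ^ b := Nat.le_pow_clog (by norm_num) m
  obtain ⟨code, hlt, hinj⟩ := exists_injOn_small_sets (Fin b × Bool) Δ
  -- For each other color `e` seen, record where `c` first differs from `e`, and the bit of `c`
  -- there. The position determines the bit, so there are at most `Δ` pairs.
  let F : ℕ → Set ℕ → Set (Fin b × Bool) := fun c K =>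
    {q | ∃ e ∈ K, e ≠ c ∧ q.1.val = firstDiff c e ∧ q.2 = c.testBit q.1.val}
  have hcard : ∀ c K, K ⊆ Set.Iio m → K.ncard ≤ Δ → (F c K).ncard ≤ Δ := by
    intro c K hKm hK
    have hfin : K.Finite := (Set.finite_Iio m).subset hKm
    have hinjOn : Set.InjOn (fun q : Fin b × Bool => q.1.val) (F c K) := by
      rintro ⟨i, x⟩ ⟨_, _, _, -, hx⟩ ⟨j, y⟩ ⟨_, _, _, -, hy⟩ hij
      have hij : i = j := Fin.ext hij
      subst hij
      rw [Prod.mk.injEq]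
      exact ⟨rfl, hx.trans hy.symm⟩
    rw [← hinjOn.ncard_image]
    refine le_trans (Set.ncard_le_ncard (t := firstDiff c '' K) ?_ (hfin.image _))
      ((Set.ncard_image_le hfin).trans hK)
    rintro _ ⟨q, ⟨e, he, -, h, -⟩, rfl⟩
    exact ⟨e, he, h.symm⟩
  refine ⟨fun c K => code (F c K), fun c K => ?_, ?_⟩
  · have := hlt (F c K)
    simpa [paletteSize] using this
  · intro c c' K K' hne hK hK' hn hn' hcK hcK' hc'K hc'K' heq
    have hF := hinj _ _ (hcard c K hK hn) (hcard c' K' hK' hn') heq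
    have hi : firstDiff c c' < b :=
      firstDiff_lt hne ((hK hcK).trans_le hmb) ((hK hc'K).trans_le hmb)
    -- If the two sets agreed, this pair would also record a bit of `c'`, and `c` and `c'` would
    -- have the same bit at their first difference.
    have h1 : ((⟨firstDiff c c', hi⟩, c.testBit (firstDiff c c')) : Fin b × Bool) ∈ F c K :=
      ⟨c', hc'K, hne.symm, rfl, rfl⟩
    rw [hF] at h1
    obtain ⟨_, _, _, -, h⟩ := h1
    exact testBit_firstDiff hne h

/-- A function as in `exists_recoloring`. -/
noncomputable def recolor (Δ m : ℕ) : ℕ → Set ℕ → ℕ := (exists_recoloring Δ m).choose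

end ColorReduction

/-! ### The schedule obtained from a coloring -/

section Schedule

open blockCycle

variable {V : Type*}

/-- The `i`-th set of the schedule that eliminates the color classes of `α` one after the other
and adds each node of `β` as soon as all of its neighbors have been eliminated. -/
def colorSchedule (G : SimpleGraph V) (α β : Set V) (col : V → ℕ) (i : ℕ) : Set V :=
  {v | (v ∈ α ∧ (i + 1) / 2 ≤ col v) ∨ (v ∈ β ∧ ∀ u, G.Adj v u → u ∈ α → col u < i / 2)}

variable {G : SimpleGraph V} {α β : Set V} {col : V → ℕ}

/-- Nodes of `β` are dominated within distance 3, hence nodes of `α` within distance 4. The critical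
case is a node `w` of `β` whose neighbor `v` has just been removed while `w` has not yet been
inserted. Then `hfar` leads to a node `y` of `β` not adjacent to `v`: either `y` is already present,
or it has a neighbor `z ≠ v` in `α` that is not yet due for removal before this phase. As `z` is
within distance 4 of `v`, its color differs from that of `v`, so it is still present. -/
lemma isRulingSet_colorSchedule (hα : G.IsIndepSet α) (hβ : G.IsIndepSet β)
    (hunion : ∀ v, v ∈ α ∨ v ∈ β) (hnbr : ∀ v ∈ α, ∃ w ∈ β, G.Adj v w)
    (hcol : ∀ u ∈ α, ∀ v ∈ α, u ≠ v → u ∈ ball G 4 v → col u ≠ col v)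
    (hfar : ∀ v ∈ α, ∀ w ∈ β, G.Adj v w →
      ∃ x ∈ α, ∃ y ∈ β, G.Adj w x ∧ G.Adj x y ∧ ¬ G.Adj v y) (i : ℕ) :
    IsRulingSet G 2 4 (colorSchedule G α β col i) := by
  have hle : i / 2 ≤ (i + 1) / 2 := by omega
  have hle' : (i + 1) / 2 ≤ i / 2 + 1 := by omega
  constructor
  · intro u hu v hv hne
    have hnadj : ¬ G.Adj u v := by
      intro hadj
      rcases hu with ⟨hu, hu'⟩ | ⟨hu, hu'⟩ <;> rcases hv with ⟨hv, hv'⟩ | ⟨hv, hv'⟩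
      · exact hα hu hv hne hadj
      · have := hv' u hadj.symm hu
        omega
      · have := hu' v hadj hv
        omega
      · exact hβ hu hv hne hadj
    by_contra h
    push Not at h
    have h1 : G.edist u v ≤ 1 := Order.le_of_lt_add_one (by simpa [one_add_one_eq_two] using h)
    rcases SimpleGraph.edist_le_one_iff_adj_or_eq.1 h1 with h | h
    exacts [hnadj h, hne h]
  have hβwalk : ∀ w ∈ β, ∃ u ∈ colorSchedule G α β col i, ∃ p : G.Walk w u, p.length ≤ 3 := by
    intro w hw
    by_cases hwS : ∀ u, G.Adj w u → u ∈ α → col u < i / 2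
    · exact ⟨w, Or.inr ⟨hw, hwS⟩, .nil, by simp⟩
    push Not at hwS
    obtain ⟨v, hwv, hv, hvcol⟩ := hwS
    by_cases hva : (i + 1) / 2 ≤ col v
    · exact ⟨v, Or.inl ⟨hv, hva⟩, .cons hwv .nil, by simp⟩
    -- Here `i / 2 ≤ col v < (i + 1) / 2`, so `i` is odd and `col v = i / 2`: the color being
    -- exchanged.
    obtain ⟨x, hx, y, hy, hwx, hxy, hvy⟩ := hfar v hv w hw hwv.symm
    by_cases hyS : ∀ u, G.Adj y u → u ∈ α → col u < i / 2
    · exact ⟨y, Or.inr ⟨hy, hyS⟩, .cons hwx (.cons hxy .nil), by simp⟩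
    push Not at hyS
    obtain ⟨z, hyz, hz, hzcol⟩ := hyS
    have hzv : z ≠ v := by
      rintro rfl
      exact hvy hyz.symm
    have := hcol z hz v hv hzv ⟨.cons hwv.symm (.cons hwx (.cons hxy (.cons hyz .nil))), by simp⟩
    exact ⟨z, Or.inl ⟨hz, by omega⟩, .cons hwx (.cons hxy (.cons hyz .nil)), by simp⟩
  intro v _
  rcases hunion v with hv | hv
  · obtain ⟨w, hw, hvw⟩ := hnbr v hv
    obtain ⟨u, hu, p, hp⟩ := hβwalk w hw
    refine ⟨u, hu, (SimpleGraph.edist_le (p.cons hvw)).trans ?_⟩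
    rw [SimpleGraph.Walk.length_cons]
    exact_mod_cast Nat.succ_le_succ hp
  · obtain ⟨u, hu, p, hp⟩ := hβwalk v hv
    refine ⟨u, hu, (SimpleGraph.edist_le p).trans ?_⟩
    exact_mod_cast hp.trans (by norm_num)

lemma isReconfigurationSchedule_colorSchedule (hα : G.IsIndepSet α) (hβ : G.IsIndepSet β)
    (hunion : ∀ v, v ∈ α ∨ v ∈ β)
    (hnbr : ∀ v ∈ α, ∃ w ∈ β, G.Adj v w) (hnbr' : ∀ v ∈ β, ∃ w ∈ α, G.Adj v w)
    (hcol : ∀ u ∈ α, ∀ v ∈ α, u ≠ v → u ∈ ball G 4 v → col u ≠ col v)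
    (hfar : ∀ v ∈ α, ∀ w ∈ β, G.Adj v w →
      ∃ x ∈ α, ∃ y ∈ β, G.Adj w x ∧ G.Adj x y ∧ ¬ G.Adj v y)
    {M ℓ : ℕ} (hM : ∀ v, v ∈ α → col v < M) (hℓ : 2 * M ≤ ℓ) :
    IsReconfigurationSchedule G (IsRulingSet G 2 4) α β ℓ
      (fun i => colorSchedule G α β col i) where
  first := by
    ext v
    simp only [colorSchedule, Fin.val_zero, Set.mem_ofPred_eq]
    constructor
    · rintro (⟨h, -⟩ | ⟨h, h'⟩)
      · exact h
      · obtain ⟨w, hw, hvw⟩ := hnbr' v h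
        simpa using h' w hvw hw
    · exact fun h => Or.inl ⟨h, by simp⟩
  last := by
    ext v
    simp only [colorSchedule, Fin.val_last, Set.mem_ofPred_eq]
    constructor
    · rintro (⟨h, h'⟩ | ⟨h, -⟩)
      · have := hM v h
        omega
      · exact h
    · refine fun h => Or.inr ⟨h, fun u _ hu => ?_⟩
      have := hM u hu
      omega
  property i _ _ := isRulingSet_colorSchedule hα hβ hunion hnbr hcol hfar i
  step i := by
    -- Steps from even indices only remove nodes of `α`, and steps from odd indices only insert
    -- nodes of `β`, so each change lies in one independent set.
    have hiff : ∀ v, v ∈ colorSchedule G α β col (i.succ : Fin (ℓ + 1)) ∆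
        colorSchedule G α β col (i.castSucc : Fin (ℓ + 1)) →
        ((i : ℕ) % 2 = 0 → v ∈ α) ∧ ((i : ℕ) % 2 = 1 → v ∈ β) := by
      intro v hv
      constructor
      · intro hi
        by_contra hvα
        have h : ((i : ℕ) + 1) / 2 = (i : ℕ) / 2 := by omega
        have hiff : v ∈ colorSchedule G α β col (i + 1) ↔ v ∈ colorSchedule G α β col i := by
          simp [colorSchedule, hvα, h]
        rw [Set.mem_symmDiff, Fin.val_succ, Fin.val_castSucc] at hv
        tauto
      · intro hi
        by_contra hvβ
        have h : ((i : ℕ) + 1 + 1) / 2 = ((i : ℕ) + 1) / 2 := by omega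
        have hiff : v ∈ colorSchedule G α β col (i + 1) ↔ v ∈ colorSchedule G α β col i := by
          simp [colorSchedule, hvβ, h]
        rw [Set.mem_symmDiff, Fin.val_succ, Fin.val_castSucc] at hv
        tauto
    intro u hu v hv
    rcases Nat.mod_two_eq_zero_or_one (i : ℕ) with h | h
    · exact hα ((hiff u hu).1 h) ((hiff v hv).1 h)
    · exact hβ ((hiff u hu).2 h) ((hiff v hv).2 h)

end Schedule

/-! ### The distributed algorithm and its correctness -/

/-- The state of a node during the color reduction: the number of nodes of the network, the number
of rounds so far, whether the node belongs to `α`, its color, and the colors that it has received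
since the last recoloring. -/
structure ReductionState where
  size : ℕ
  round : ℕ
  inAlpha : Prop
  color : ℕ
  known : Set ℕ

/-- The algorithm that repeatedly collects the colors of the nodes of `α` at distance at most `4`
and recolors the nodes accordingly. The output follows `colorSchedule`. -/
noncomputable def scheduleAlgorithm (Δ d ℓ : ℕ) :
    LocalAlgorithm (Prop × Prop) (Set (Fin (ℓ + 1))) where
  State := ReductionState
  Message := Set ℕ
  init n c q := ⟨n, 0, q.1, c, {e | e = c ∧ q.1}⟩
  send σ _ := σ.known
  receive σ msgs :=
    let K := σ.known ∪ {e | ∃ p ∈ msgs, e ∈ p.2}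
    -- Four rounds of flooding collect the colors in the ball of radius 4. The size of the current
    -- palette is computed from `n` and the phase number alone, so all nodes use the same `recolor`.
    if σ.round % 4 = 3 then
      let c := recolor Δ ((paletteSize Δ)^[σ.round / 4] (σ.size ^ d)) σ.color K
      ⟨σ.size, σ.round + 1, σ.inAlpha, c, {e | e = c ∧ σ.inAlpha}⟩
    else ⟨σ.size, σ.round + 1, σ.inAlpha, σ.color, K⟩
  output σ :=
    {i | (σ.inAlpha ∧ ((i : ℕ) + 1) / 2 ≤ σ.color) ∨
      (¬ σ.inAlpha ∧ ∀ e ∈ σ.known, e < (i : ℕ) / 2)}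

section Correctness

open blockCycle

lemma image_ball_zero_inter {V : Type*} (G : SimpleGraph V) (α : Set V) (col : V → ℕ) (v : V) :
    col '' (ball G 0 v ∩ α) = {e | e = col v ∧ v ∈ α} := by
  ext e
  simp only [Set.mem_image, Set.mem_inter_iff, mem_ball_zero, Set.mem_ofPred_eq]
  constructor
  · rintro ⟨u, ⟨rfl, hu⟩, rfl⟩
    exact ⟨rfl, hu⟩
  · rintro ⟨rfl, hv⟩
    exact ⟨v, ⟨rfl, hv⟩, rfl⟩

variable {V : Type} [Fintype V] (G : SimpleGraph V) (α β : Set V) (ident : V → ℕ) (Δ d : ℕ)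

/-- The colors after `j` steps of color reduction. -/
noncomputable def phaseColor : ℕ → V → ℕ
  | 0, v => ident v
  | j + 1, v => recolor Δ ((paletteSize Δ)^[j] (Fintype.card V ^ d)) (phaseColor j v)
      (phaseColor j '' (ball G 4 v ∩ α))

lemma scheduleAlgorithm_stateAfter (ℓ : ℕ) (j r : ℕ) (hr : r ≤ 3) (v : V) :
    (scheduleAlgorithm Δ d ℓ).stateAfter G ident (fun u => (u ∈ α, u ∈ β)) (4 * j + r) v =
      (⟨Fintype.card V, 4 * j + r, v ∈ α, phaseColor G α ident Δ d j v,
        phaseColor G α ident Δ d j '' (ball G r v ∩ α)⟩ : ReductionState) := by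
  have main : ∀ t v, (scheduleAlgorithm Δ d ℓ).stateAfter G ident (fun u => (u ∈ α, u ∈ β)) t v =
      (⟨Fintype.card V, t, v ∈ α, phaseColor G α ident Δ d (t / 4) v,
        phaseColor G α ident Δ d (t / 4) '' (ball G (t % 4) v ∩ α)⟩ : ReductionState) := by
    intro t
    induction t with
    | zero =>
      intro v
      simp only [Nat.zero_div, Nat.zero_mod, image_ball_zero_inter]
      rfl
    | succ t ih =>
      intro v
      have hK : ∀ col : V → ℕ, col '' (ball G (t % 4) v ∩ α) ∪
          {e | ∃ p ∈ {p : ℕ × Set ℕ | ∃ u, G.Adj v u ∧ p =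
            (ident u, col '' (ball G (t % 4) u ∩ α))}, e ∈ p.2} =
          col '' (ball G (t % 4 + 1) v ∩ α) := by
        intro col
        ext e
        simp only [Set.mem_union, Set.mem_image, Set.mem_inter_iff, mem_ball_succ,
          Set.mem_ofPred_eq]
        constructor
        · rintro (⟨u, ⟨h1, h2⟩, rfl⟩ | ⟨_, ⟨w, hw, rfl⟩, u, ⟨h1, h2⟩, rfl⟩)
          · exact ⟨u, ⟨Or.inl h1, h2⟩, rfl⟩
          · exact ⟨u, ⟨Or.inr ⟨w, hw, h1⟩, h2⟩, rfl⟩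
        · rintro ⟨u, ⟨h1 | ⟨w, hw, h1⟩, h2⟩, rfl⟩
          · exact Or.inl ⟨u, ⟨h1, h2⟩, rfl⟩
          · exact Or.inr ⟨_, ⟨w, hw, rfl⟩, u, ⟨h1, h2⟩, rfl⟩
      have hstep : (scheduleAlgorithm Δ d ℓ).stateAfter G ident (fun u => (u ∈ α, u ∈ β)) (t + 1) v
          = (scheduleAlgorithm Δ d ℓ).receive
            (⟨Fintype.card V, t, v ∈ α, phaseColor G α ident Δ d (t / 4) v,
              phaseColor G α ident Δ d (t / 4) '' (ball G (t % 4) v ∩ α)⟩ : ReductionState)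
            {p | ∃ u, G.Adj v u ∧ p = (ident u,
              phaseColor G α ident Δ d (t / 4) '' (ball G (t % 4) u ∩ α))} := by
        simp only [LocalAlgorithm.stateAfter, ih]
        rfl
      rw [hstep]
      have hrec := hK (phaseColor G α ident Δ d (t / 4))
      simp only [scheduleAlgorithm]
      by_cases h3 : t % 4 = 3
      · have h1 : (t + 1) / 4 = t / 4 + 1 := by omega
        have h2 : (t + 1) % 4 = 0 := by omega
        rw [if_pos h3, h1, h2, image_ball_zero_inter, hrec, h3]
        rfl
      · have h1 : (t + 1) / 4 = t / 4 := by omega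
        have h2 : (t + 1) % 4 = t % 4 + 1 := by omega
        rw [if_neg h3, h1, h2, hrec]
  rw [main]
  have h1 : (4 * j + r) / 4 = j := by omega
  have h2 : (4 * j + r) % 4 = r := by omega
  rw [h1, h2]

variable {G α β ident Δ d}

lemma phaseColor_spec (hinj : Function.Injective ident) (hlt : ∀ v, ident v < Fintype.card V ^ d)
    (hball : ∀ v, (ball G 4 v).ncard ≤ Δ) (j : ℕ) :
    (∀ v, phaseColor G α ident Δ d j v < (paletteSize Δ)^[j] (Fintype.card V ^ d)) ∧
    ∀ u ∈ α, ∀ v ∈ α, u ≠ v → u ∈ ball G 4 v →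
      phaseColor G α ident Δ d j u ≠ phaseColor G α ident Δ d j v := by
  induction j with
  | zero => exact ⟨hlt, fun u _ v _ h _ => hinj.ne h⟩
  | succ j ih =>
    obtain ⟨ih1, ih2⟩ := ih
    have hspec := (exists_recoloring Δ ((paletteSize Δ)^[j] (Fintype.card V ^ d))).choose_spec
    constructor
    · intro v
      rw [Function.iterate_succ_apply']
      exact hspec.1 _ _
    · intro u hu v hv hne huv
      have hsub : ∀ w, phaseColor G α ident Δ d j '' (ball G 4 w ∩ α) ⊆
          Set.Iio ((paletteSize Δ)^[j] (Fintype.card V ^ d)) := by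
        rintro w _ ⟨x, -, rfl⟩
        exact ih1 x
      have hcard : ∀ w, (phaseColor G α ident Δ d j '' (ball G 4 w ∩ α)).ncard ≤ Δ := fun w =>
        (Set.ncard_image_le (Set.toFinite _)).trans
          ((Set.ncard_le_ncard Set.inter_subset_left (Set.toFinite _)).trans (hball w))
      have hself : ∀ w : V, w ∈ ball G 4 w := fun w => ⟨.nil, by simp⟩
      exact hspec.2 _ _ _ _ (ih2 u hu v hv hne huv) (hsub u) (hsub v) (hcard u) (hcard v)
        ⟨u, ⟨hself u, hu⟩, rfl⟩ ⟨u, ⟨huv, hu⟩, rfl⟩ ⟨v, ⟨mem_ball_comm.1 huv, hv⟩, rfl⟩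
        ⟨v, ⟨hself v, hv⟩, rfl⟩

/-- The one round after the last phase tells each node of `β` the final colors of its neighbors in
`α`. -/
lemma scheduleAlgorithm_outputAfter (hcompl : ∀ v, v ∈ β ↔ v ∉ α)
    (ℓ j : ℕ) (i : Fin (ℓ + 1)) :
    {v | i ∈ (scheduleAlgorithm Δ d ℓ).outputAfter G ident (fun u => (u ∈ α, u ∈ β))
      (4 * j + 1) v} = colorSchedule G α β (phaseColor G α ident Δ d j) i := by
  ext v
  rw [Set.mem_ofPred_eq, LocalAlgorithm.outputAfter,
    scheduleAlgorithm_stateAfter G α β ident Δ d ℓ j 1 (by norm_num) v]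
  simp only [scheduleAlgorithm, colorSchedule, Set.mem_ofPred_eq, hcompl]
  refine or_congr Iff.rfl (and_congr_right fun hv => ?_)
  constructor
  · exact fun h u hvu hu => h _ ⟨u, ⟨⟨.cons hvu .nil, by simp⟩, hu⟩, rfl⟩
  · rintro h _ ⟨u, ⟨hb, hu⟩, rfl⟩
    rcases mem_ball_succ.1 hb with hb | ⟨w, hw, hb⟩
    · rw [mem_ball_zero] at hb
      exact absurd (hb ▸ hu) hv
    · rw [mem_ball_zero] at hb
      subst hb
      exact h u hw hu

end Correctness

/-- The chain of `m + 3` blocks, to be reconfigured from the layers `false` to the layers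
`true`. -/
def blockCycleInput (s m : ℕ) : ReconfigurationInput where
  V := ZMod (m + 3) × Bool × Fin s
  graph := blockCycle (m + 3) s
  α := blockCycle.side (m + 3) s false
  β := blockCycle.side (m + 3) s true
  maximal_α := blockCycle.maximal_side false
  maximal_β := blockCycle.maximal_side true

lemma card_blockCycleInput (s m : ℕ) :
    Fintype.card (blockCycleInput s m).V = (m + 3) * (2 * s) := by
  change Fintype.card (ZMod (m + 3) × Bool × Fin s) = _
  simp

namespace blockCycle

/-- The path continues past `w` in the direction leading away from `v`. A node of a layer `false`
has neighbors only in its own block and the preceding one, and with at least three blocks the node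
`y` lies in neither. -/
lemma exists_far_node {m s : ℕ} (v w : ZMod (m + 3) × Bool × Fin s) (hv : v.2.1 = false)
    (hw : w.2.1 = true) (h : (blockCycle (m + 3) s).Adj v w) :
    ∃ x ∈ side (m + 3) s false, ∃ y ∈ side (m + 3) s true, (blockCycle (m + 3) s).Adj w x ∧
      (blockCycle (m + 3) s).Adj x y ∧ ¬ (blockCycle (m + 3) s).Adj v y := by
  have h1 : ∀ i : ZMod (m + 3), i + 1 ≠ i := by
    intro i hi
    have : Fact (1 < m + 3) := ⟨by omega⟩
    simp at hi
  have h2 : ∀ i : ZMod (m + 3), i + 1 + 1 ≠ i := by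
    intro i hi
    have h0 : ((2 : ℕ) : ZMod (m + 3)) = 0 := by
      push_cast
      linear_combination hi
    rw [ZMod.natCast_eq_zero_iff] at h0
    have := Nat.le_of_dvd (by norm_num) h0
    omega
  obtain ⟨i, b, x⟩ := v
  obtain ⟨j, c, y⟩ := w
  obtain rfl : b = false := hv
  obtain rfl : c = true := hw
  rcases adj_false_true.1 h with rfl | ⟨rfl, rfl⟩
  · refine ⟨(j + 1, false, y), rfl, (j + 1, true, y), rfl, adj_true_false.2 (Or.inr ⟨rfl, rfl⟩),
      adj_false_true.2 (Or.inl rfl), fun h => ?_⟩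
    rcases adj_false_true.1 h with h | ⟨h, -⟩
    · exact h1 _ h
    · exact h2 _ h.symm
  · refine ⟨(j, false, x), rfl, (j - 1, true, x), rfl, adj_true_false.2 (Or.inl rfl),
      adj_false_true.2 (Or.inr ⟨by ring, rfl⟩), fun h => ?_⟩
    rcases adj_false_true.1 h with h | ⟨h, -⟩
    · exact h2 (j - 1) (by linear_combination -h)
    · exact h1 j (by linear_combination h)

end blockCycle

lemma scheduleAlgorithm_findsSchedule (s d : ℕ) {ℓ M j n : ℕ}
    (hj : (paletteSize (18 * s))^[j] (n ^ d) ≤ M) (hℓ : 2 * M ≤ ℓ) :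
    FindsSchedule (scheduleAlgorithm (18 * s) d ℓ) (Set.range (blockCycleInput s)) d n
      (4 * j + 1) := by
  rintro _ ⟨m, rfl⟩ hn ident hinj hlt
  have hcompl : ∀ v : (blockCycleInput s m).V,
      v ∈ (blockCycleInput s m).β ↔ v ∉ (blockCycleInput s m).α := by
    rintro (v : ZMod (m + 3) × Bool × Fin s)
    change v.2.1 = true ↔ ¬ v.2.1 = false
    simp
  have hα := (blockCycleInput s m).maximal_α.prop
  have hβ := (blockCycleInput s m).maximal_β.prop
  have hother : ∀ v : (blockCycleInput s m).V, ∃ w : (blockCycleInput s m).V,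
      (blockCycleInput s m).graph.Adj v w ∧
        (v ∈ (blockCycleInput s m).α → w ∈ (blockCycleInput s m).β) ∧
        (v ∈ (blockCycleInput s m).β → w ∈ (blockCycleInput s m).α) := by
    intro v
    obtain ⟨w, hvw, hw⟩ := blockCycle.exists_adj_other_side (m := m + 3) (s := s) v
    refine ⟨w, hvw, fun h => ?_, fun h => ?_⟩
    · exact hw.trans (by rw [show Prod.fst (Prod.snd v) = false from h]; rfl)
    · exact hw.trans (by rw [show Prod.fst (Prod.snd v) = true from h]; rfl)
  rw [← hn] at hj hlt
  obtain ⟨hcol1, hcol2⟩ := phaseColor_spec (G := (blockCycleInput s m).graph)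
    (α := (blockCycleInput s m).α) (Δ := 18 * s) hinj hlt
    (blockCycle.ncard_ball_four_le (m := m + 3) (s := s)) j
  have := isReconfigurationSchedule_colorSchedule (ℓ := ℓ) hα hβ
    (fun v => by rw [hcompl]; exact em _)
    (fun v hv => (hother v).imp fun w h => ⟨h.2.1 hv, h.1⟩)
    (fun v hv => (hother v).imp fun w h => ⟨h.2.2 hv, h.1⟩) hcol2
    (fun v hv w hw h => blockCycle.exists_far_node (m := m) (s := s) v w hv hw h)
    (fun v _ => (hcol1 v).trans_le hj) hℓ
  convert this using 2
  exact scheduleAlgorithm_outputAfter hcompl ℓ j _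

/-! ### Estimates for towers -/

section Tower

lemma monotone_two_rpow : Monotone (fun y : ℝ => (2 : ℝ) ^ y) := fun _ _ h =>
  Real.rpow_le_rpow_of_exponent_le (by norm_num) h

lemma monotone_iterate_two_rpow_one : Monotone (fun t : ℕ => (fun y : ℝ => (2 : ℝ) ^ y)^[t] 1) := by
  refine monotone_nat_of_le_succ fun t => ?_
  rw [Function.iterate_succ_apply]
  exact monotone_two_rpow.iterate t (by norm_num)

/-- A constant factor is absorbed at the top of the tower, since `a * 2 ^ y ≤ 2 ^ (a - 1 + y) ≤ 2 ^
(a * y)` for `a, y ≥ 1`. This passes from the number of blocks to the number of nodes. -/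
lemma mul_iterate_two_rpow_le {a : ℕ} (ha : 1 ≤ a) (t : ℕ) :
    (a : ℝ) * (fun y : ℝ => (2 : ℝ) ^ y)^[t] 1 ≤ (fun y : ℝ => (2 : ℝ) ^ y)^[t] a := by
  induction t with
  | zero => simp
  | succ t ih =>
    rw [Function.iterate_succ_apply', Function.iterate_succ_apply']
    refine le_trans ?_ (monotone_two_rpow ih)
    set y := (fun y : ℝ => (2 : ℝ) ^ y)^[t] 1 with hy
    have hy1 : 1 ≤ y := by
      have := nat_le_iterate_two_rpow t
      have h0 : (0 : ℝ) ≤ t := by positivity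
      linarith
    have ha' : (1 : ℝ) ≤ a := by exact_mod_cast ha
    have h1 : (a : ℝ) ≤ 2 ^ ((a : ℝ) - 1) := by
      have h : a ≤ 2 ^ (a - 1) := by
        have := Nat.lt_two_pow_self (n := a - 1)
        omega
      rw [show (a : ℝ) - 1 = ((a - 1 : ℕ) : ℝ) by push_cast [ha]; ring, Real.rpow_natCast]
      exact_mod_cast h
    calc (a : ℝ) * 2 ^ y ≤ 2 ^ ((a : ℝ) - 1) * 2 ^ y :=
          mul_le_mul_of_nonneg_right h1 (by positivity)
      _ = 2 ^ ((a : ℝ) - 1 + y) := (Real.rpow_add (by norm_num) _ _).symm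
      _ ≤ 2 ^ (a * y) := monotone_two_rpow (by nlinarith)

lemma iterate_two_rpow_natCast_le (t a : ℕ) :
    (fun y : ℝ => (2 : ℝ) ^ y)^[t] a ≤ (fun y : ℝ => (2 : ℝ) ^ y)^[t + a] 1 := by
  rw [Function.iterate_add_apply]
  exact monotone_two_rpow.iterate t (by linarith [nat_le_iterate_two_rpow a])

end Tower

/-! ### Lower bound: colorings of shifts and indistinguishable blocks -/

/-- A coloring of the increasing sequences of length `r + 1` in `{0, …, N - 1}` that separates
each sequence from its shifts needs many colors. -/
lemma le_iterate_of_shift_coloring (N r : ℕ) :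
    ∀ (C : Type) [Fintype C] (c : (ℕ → ℕ) → C),
      (∀ x y, (∀ i ≤ r, x i = y i) → c x = c y) →
      (∀ x : ℕ → ℕ, (∀ i ≤ r, x i < x (i + 1)) → x (r + 1) < N → c x ≠ c fun i => x (i + 1)) →
      (N : ℝ) ≤ (fun y : ℝ => (2 : ℝ) ^ y)^[r] (Fintype.card C) := by
  induction r with
  | zero =>
    intro C _ c hdep hproper
    have hne : ∀ a b : ℕ, a < b → b < N → c (fun _ => a) ≠ c fun _ => b := by
      intro a b hab hb
      have h := hproper (fun i => if i = 0 then a else b) (by simpa using hab) (by simpa using hb)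
      rw [hdep _ (fun _ => a) (by simp)] at h
      simpa using h
    have hinj : Function.Injective (fun a : Fin N => c fun _ => a.val) := by
      intro a b h
      rcases lt_trichotomy a b with hab | hab | hab
      · exact absurd h (hne _ _ hab b.2)
      · exact hab
      · exact absurd h.symm (hne _ _ hab a.2)
    have := Fintype.card_le_of_injective _ hinj
    rw [Fintype.card_fin] at this
    simpa using this
  | succ r ih =>
    intro C _ c hdep hproper
    rw [Function.iterate_succ_apply]
    have hcard : (2 : ℝ) ^ (Fintype.card C : ℝ) = (Fintype.card (Set C) : ℝ) := by
      rw [Fintype.card_set, Real.rpow_natCast]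
      push_cast
      rfl
    simp only [hcard]
    -- The new color of a shorter sequence is the set of colors of its increasing one-term
    -- extensions; this is the source of one exponential per step.
    refine ih (Set C) (fun x => {e | ∃ y : ℕ → ℕ, (∀ i ≤ r, y i = x i) ∧
      (∀ i ≤ r, y i < y (i + 1)) ∧ y (r + 1) < N ∧ c y = e}) ?_ ?_
    · intro x x' hx
      ext e
      simp only [Set.mem_ofPred_eq]
      refine exists_congr fun y => and_congr_left fun _ => ?_
      exact forall₂_congr fun i hi => by rw [hx i hi]
    · intro x hx hxN heq
      have hmem : c x ∈ {e | ∃ y : ℕ → ℕ, (∀ i ≤ r, y i = x i) ∧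
          (∀ i ≤ r, y i < y (i + 1)) ∧ y (r + 1) < N ∧ c y = e} :=
        ⟨x, fun _ _ => rfl, hx, hxN, rfl⟩
      rw [heq] at hmem
      obtain ⟨y, hyx, hy, hyN, hcy⟩ := hmem
      -- `y` extends the shift of `x` and has the color of `x`. Prepending `x 0` gives a sequence
      -- `z` that agrees with `x` where `c` looks and has `y` as its shift, contradicting
      -- properness.
      let z : ℕ → ℕ := fun i => Nat.casesOn i (x 0) y
      refine hproper z ?_ hyN ?_
      · rintro (_ | i) hi
        · change x 0 < y 0
          rw [hyx 0 (Nat.zero_le _)]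
          exact hx 0 (Nat.zero_le _)
        · exact hy i (by omega)
      · change c z = c y
        rw [hcy]
        refine hdep _ _ ?_
        rintro (_ | i) hi
        · rfl
        · exact hyx i (by omega)

namespace blockCycle

variable {m s : ℕ}

lemma adj_add_right {i j : ZMod m} {p q : Bool × Fin s} (a : ZMod m) :
    (blockCycle m s).Adj (i + a, p) (j + a, q) ↔ (blockCycle m s).Adj (i, p) (j, q) := by
  have h : ∀ i j : ZMod m, i + a = j + a + 1 ↔ i = j + 1 := fun i j =>
    ⟨fun h => by linear_combination h, fun h => by linear_combination h⟩
  simp [blockCycle, h]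

/-- In `t` rounds the nodes of block `i` only learn about the blocks at distance at most `t`. -/
lemma stateAfter_eq_of_shift [NeZero m] {I O : Type} (A : LocalAlgorithm I O)
    (id₁ id₂ : ZMod m × Bool × Fin s → ℕ) (input : Bool × Fin s → I) (τ : ℤ) (t : ℕ) :
    ∀ i : ℤ, (∀ j : ℤ, |j - i| ≤ t → ∀ p, id₁ ((j : ZMod m), p) = id₂ (((j + τ : ℤ) : ZMod m), p)) →
      ∀ p, A.stateAfter (blockCycle m s) id₁ (fun v => input v.2) t ((i : ZMod m), p) =
        A.stateAfter (blockCycle m s) id₂ (fun v => input v.2) t (((i + τ : ℤ) : ZMod m), p) := by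
  induction t with
  | zero =>
    intro i h p
    simp only [LocalAlgorithm.stateAfter]
    rw [h i (by simp) p]
  | succ t ih =>
    intro i h p
    have hnear : ∀ j : ℤ, |j - i| ≤ 1 → ∀ q,
        A.stateAfter (blockCycle m s) id₁ (fun v => input v.2) t ((j : ZMod m), q) =
          A.stateAfter (blockCycle m s) id₂ (fun v => input v.2) t (((j + τ : ℤ) : ZMod m), q) := by
      intro j hj
      refine ih j fun l hl => h l ?_
      have := abs_sub_le l j i
      push_cast
      linarith
    have hid : ∀ j : ℤ, |j - i| ≤ 1 → ∀ q, id₁ ((j : ZMod m), q) = id₂ (((j + τ : ℤ) : ZMod m), q) :=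
      fun j hj => h j (by push_cast; linarith [(Nat.cast_nonneg t : (0 : ℤ) ≤ t)])
    simp only [LocalAlgorithm.stateAfter]
    rw [hnear i (by simp) p, hid i (by simp) p]
    congr 1
    ext msg
    constructor
    · rintro ⟨⟨j', q⟩, hadj, rfl⟩
      obtain ⟨j, hj, rfl : j' = j⟩ := exists_block_of_adj hadj rfl
      refine ⟨(((j + τ : ℤ) : ZMod m), q), ?_, ?_⟩
      · push_cast
        exact (adj_add_right _).2 hadj
      · rw [hid j hj, hnear j hj]
    · rintro ⟨⟨j', q⟩, hadj, rfl⟩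
      obtain ⟨j, hj, rfl : j' = j⟩ := exists_block_of_adj hadj rfl
      have hj' : |(j - τ) - i| ≤ 1 := by
        rwa [show j - τ - i = j - (i + τ) by ring]
      have hcast : j - τ + τ = j := by ring
      refine ⟨(((j - τ : ℤ) : ZMod m), q), ?_, ?_⟩
      · rw [← adj_add_right (τ : ZMod m)]
        rw [← Int.cast_add, ← Int.cast_add, hcast]
        exact hadj
      · rw [hid _ hj', hnear _ hj', hcast]

/-- A schedule from one side to the other cannot treat `9` consecutive blocks alike. -/
lemma false_of_blocks_alike [NeZero s] {ℓ : ℕ}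
    {S : Fin (ℓ + 1) → Set (ZMod m × Bool × Fin s)}
    (hS : IsReconfigurationSchedule (blockCycle m s) (IsRulingSet (blockCycle m s) 2 4)
      (side m s false) (side m s true) ℓ S) (b : ℤ)
    (h : ∀ j : ℤ, |j - b| ≤ 4 → ∀ p i, ((j : ZMod m), p) ∈ S i ↔ ((b : ZMod m), p) ∈ S i) :
    False := by
  -- Invariant for block `b`: some node of the layer `false` is present, and none of the layer
  -- `true`. It holds for `α` and fails for `β`.
  have key : ∀ i, (∃ x, ((b : ZMod m), false, x) ∈ S i) ∧ ∀ x, ((b : ZMod m), true, x) ∉ S i := by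
    intro i
    induction i using Fin.induction with
    | zero =>
      rw [hS.first]
      exact ⟨⟨0, rfl⟩, fun x hx => by simp at hx⟩
    | succ i ih =>
      obtain ⟨⟨x, hx⟩, hodd⟩ := ih
      have hadj : ∀ y, (blockCycle m s).Adj ((b : ZMod m), true, y) ((b : ZMod m), false, x) :=
        fun y => adj_true_false.2 (Or.inl rfl)
      -- A node `y` that enters is adjacent to `x`. If `x` stays, the new set is not independent; if
      -- `x` leaves, the symmetric difference is not.
      have hodd' : ∀ y, ((b : ZMod m), true, y) ∉ S i.succ := by
        intro y hy
        by_cases hx' : ((b : ZMod m), false, x) ∈ S i.succ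
        · rcases (Fin.le_last i.succ).eq_or_lt with hlast | hlast
          · rw [hlast, hS.last] at hx'
            simp at hx'
          · have h2 := (hS.property i.succ (Fin.succ_pos i) hlast).1 _ hy _ hx' (hadj y).ne
            rw [SimpleGraph.edist_eq_one_iff_adj.2 (hadj y)] at h2
            exact absurd h2 (by norm_num)
        · exact hS.step i (Set.mem_symmDiff.2 (Or.inl ⟨hy, hodd y⟩))
            (Set.mem_symmDiff.2 (Or.inr ⟨hx, hx'⟩)) (hadj y).ne (hadj y)
      refine ⟨?_, hodd'⟩
      rcases (Fin.le_last i.succ).eq_or_lt with hlast | hlast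
      · refine absurd ?_ (hodd' 0)
        rw [hlast, hS.last]
        rfl
      -- The dominating node lies at most four blocks away, so its copy in block `b` is present too,
      -- and must be in the layer `false`.
      · obtain ⟨⟨j', c, z⟩, hu, hdist⟩ :=
          (hS.property i.succ (Fin.succ_pos i) hlast).2 _ (hodd' 0)
        obtain ⟨p, hp⟩ := exists_walk_of_edist_le hdist
        obtain ⟨j, hj, rfl : j' = j⟩ := exists_block_of_walk p rfl
        rw [h j (hj.trans (by exact_mod_cast hp))] at hu
        cases c
        · exact ⟨z, hu⟩
        · exact absurd hu (hodd' z)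
  refine (key (Fin.last ℓ)).2 0 ?_
  rw [hS.last]
  rfl

/-- The identifier of the node `p` of a block with identifier `a`. -/
noncomputable def nodeIdent (s a : ℕ) (p : Bool × Fin s) : ℕ :=
  2 * s * a + Fintype.equivFinOfCardEq (show Fintype.card (Bool × Fin s) = 2 * s by simp) p

lemma nodeIdent_inj {a b : ℕ} {p q : Bool × Fin s} (h : nodeIdent s a p = nodeIdent s b q) :
    a = b ∧ p = q := by
  set e := Fintype.equivFinOfCardEq (show Fintype.card (Bool × Fin s) = 2 * s by simp)
  have hpos : 0 < 2 * s := (Nat.zero_le _).trans_lt (e p).2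
  have h1 : a = b := by
    have h2 := congrArg (· / (2 * s)) h
    simpa [nodeIdent, Nat.mul_add_div hpos, Nat.div_eq_of_lt (Fin.isLt _)] using h2
  subst h1
  refine ⟨rfl, e.injective (Fin.ext ?_)⟩
  simpa [nodeIdent] using h

lemma nodeIdent_lt {a M : ℕ} (h : a < M) (p : Bool × Fin s) : nodeIdent s a p < M * (2 * s) := by
  have h1 : nodeIdent s a p < 2 * s * a + 2 * s := Nat.add_lt_add_left (Fin.isLt _) _
  have h2 : (a + 1) * (2 * s) ≤ M * (2 * s) := Nat.mul_le_mul_right _ h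
  linarith

/-- Makes the identifiers prescribed on a window into a legal assignment on the whole cycle. -/
lemma exists_extension {M R : ℕ} [NeZero M] (x : ℕ → ℕ)
    (hinj : ∀ i < R, ∀ j < R, x i = x j → i = j) (hlt : ∀ i < R, x i < M) :
    ∃ π : ZMod M → ℕ, Function.Injective π ∧ (∀ a, π a < M) ∧
      ∀ a : ZMod M, a.val < R → π a = x a.val := by
  obtain ⟨g, hg⟩ := Set.MapsTo.exists_equiv_extend_of_card_eq (α := ZMod M)
    (t := Finset.range M) (by simp) (s := {a | a.val < R}) (f := fun a => x a.val)
    (fun a ha => by simpa using hlt _ ha)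
    (fun a ha b hb h => ZMod.val_injective M (hinj _ ha _ hb h))
  exact ⟨fun a => g a, Subtype.val_injective.comp g.injective,
    fun a => Finset.mem_range.1 (g a).2, hg⟩

variable {ℓ : ℕ} (A : LocalAlgorithm (Prop × Prop) (Set (Fin (ℓ + 1))))

/-- The output, after `T` rounds, of the middle block of a window of `2 * T + 1` blocks with the
identifiers `x 0, …, x (2 * T)`. -/
noncomputable def windowOutput (m s T : ℕ) [NeZero m] (x : ℕ → ℕ) (p : Bool × Fin s) :
    Set (Fin (ℓ + 1)) :=
  A.outputAfter (blockCycle m s) (fun v => nodeIdent s (x v.1.val) v.2)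
    (fun v => (v ∈ side m s false, v ∈ side m s true)) T (((T : ℤ) : ZMod m), p)

/-- The identifiers used in `windowOutput` need not be distinct outside the window. By locality they
do not matter, and `2 * T < m` keeps the window from wrapping around. -/
lemma windowOutput_eq [NeZero m] {T : ℕ} (hT : 2 * T < m) (x : ℕ → ℕ)
    (ident : ZMod m × Bool × Fin s → ℕ) (τ : ℤ)
    (h : ∀ j : ℕ, j ≤ 2 * T → ∀ p, ident (((j + τ : ℤ) : ZMod m), p) = nodeIdent s (x j) p)
    (p : Bool × Fin s) :
    windowOutput A m s T x p = A.outputAfter (blockCycle m s) ident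
      (fun v => (v ∈ side m s false, v ∈ side m s true)) T (((T + τ : ℤ) : ZMod m), p) := by
  refine congrArg A.output (stateAfter_eq_of_shift A _ _
    (fun p => (p.1 = false, p.1 = true)) τ T T (fun j hj q => ?_) p)
  rw [abs_le] at hj
  obtain ⟨j, rfl⟩ := Int.eq_ofNat_of_zero_le (show 0 ≤ j by linarith)
  have hj' : j ≤ 2 * T := by omega
  rw [h j hj' q]
  dsimp only
  rw [Int.cast_natCast, ZMod.val_natCast_of_lt (by omega)]

end blockCycle

-- A sequence whose color equals that of its shift would yield nine consecutive windows with the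
-- same output, and an instance on which the algorithm fails.
open blockCycle in
lemma le_iterate_of_findsSchedule {s : ℕ} [NeZero s] {ℓ d m T : ℕ} (hd : 1 ≤ d)
    (A : LocalAlgorithm (Prop × Prop) (Set (Fin (ℓ + 1))))
    (hA : FindsSchedule A (Set.range (blockCycleInput s)) d ((m + 3) * (2 * s)) T)
    (hT : 2 * T + 9 ≤ m + 3) :
    ((m + 3 : ℕ) : ℝ) ≤ (fun y : ℝ => (2 : ℝ) ^ y)^[2 * T + 7]
      (Fintype.card (Fin 8 → Bool × Fin s → Set (Fin (ℓ + 1)))) := by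
  classical
  set F := windowOutput A (m + 3) s T with hF
  have hFdep : ∀ x y : ℕ → ℕ, (∀ i ≤ 2 * T, x i = y i) → F x = F y := by
    intro x y hxy
    funext p
    refine (windowOutput_eq A (by omega) x (fun v => nodeIdent s (y v.1.val) v.2) 0
      (fun j hj q => ?_) p).trans ?_
    · rw [hxy j hj, add_zero, Int.cast_natCast]
      dsimp only
      rw [ZMod.val_natCast_of_lt (by omega)]
    · rw [add_zero]
      rfl
  -- Eight windows of `2 * T + 1` blocks, each shifted by one, span `2 * T + 8` identifiers.
  -- Equality of the 8-tuple with its shift makes nine consecutive outputs equal.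
  refine le_iterate_of_shift_coloring (m + 3) (2 * T + 7) _
    (fun x τ => F fun i => x (i + τ)) (fun x y hxy => ?_) (fun x hx hxN heq => ?_)
  · funext τ
    exact hFdep _ _ fun i hi => hxy _ (by omega)
  have hshift : ∀ τ ≤ 8, F (fun i => x (i + τ)) = F x := by
    intro τ
    induction τ with
    | zero => exact fun _ => rfl
    | succ τ ih =>
      intro hτ
      rw [← ih (by omega)]
      have := congrFun heq ⟨τ, by omega⟩
      dsimp only at this
      rw [this]
      congr 1
  have hmono : ∀ i j, i < j → j < 2 * T + 9 → x i < x j := by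
    intro i j hij
    induction j, hij using Nat.le_induction with
    | base => exact fun hj => hx i (by omega)
    | succ j _ ih => exact fun hj => (ih (by omega)).trans (hx j (by omega))
  obtain ⟨π, hπ, hπlt, hπx⟩ := exists_extension (M := m + 3) (R := 2 * T + 9) x
    (fun i hi j hj h => by
      rcases lt_trichotomy i j with hij | hij | hij
      · exact absurd h (hmono i j hij hj).ne
      · exact hij
      · exact absurd h.symm (hmono j i hij hi).ne)
    (fun i hi => by
      rcases (Nat.lt_succ_iff.1 hi).eq_or_lt with h | h
      · rw [h]
        exact hxN
      · exact (hmono i _ h (by omega)).trans hxN)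
  set ident : ZMod (m + 3) × Bool × Fin s → ℕ := fun v => nodeIdent s (π v.1) v.2 with hident
  have hpos : 1 ≤ (m + 3) * (2 * s) := Nat.mul_pos (by omega) (Nat.mul_pos two_pos (NeZero.pos s))
  have hS := hA _ ⟨m, rfl⟩ (card_blockCycleInput s m) ident
    (fun u v huv => Prod.ext (hπ (nodeIdent_inj huv).1) (nodeIdent_inj huv).2)
    -- The identifiers constructed are below `n`, hence below `n ^ d` for each `d ≥ 1`.
    (fun v => (nodeIdent_lt (hπlt _) _).trans_le (Nat.le_self_pow (by omega) _))
  have hout : ∀ τ : ℕ, τ ≤ 8 → ∀ p, A.outputAfter (blockCycle (m + 3) s) ident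
      (fun v => (v ∈ side (m + 3) s false, v ∈ side (m + 3) s true)) T
        (((T + τ : ℤ) : ZMod (m + 3)), p) = F x p := by
    intro τ hτ p
    rw [← hshift τ hτ]
    refine (windowOutput_eq A (by omega) (fun i => x (i + τ)) ident τ (fun j hj q => ?_) p).symm
    have hcast : (((j + τ : ℤ)) : ZMod (m + 3)) = ((j + τ : ℕ) : ZMod (m + 3)) := by push_cast; rfl
    have hval : (((j + τ : ℕ)) : ZMod (m + 3)).val = j + τ := ZMod.val_natCast_of_lt (by omega)
    simp only [hident]
    rw [hcast, hπx _ (by rw [hval]; omega), hval]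
  have hout' : ∀ j : ℤ, |j - (T + 4)| ≤ 4 → ∀ p, A.outputAfter (blockCycle (m + 3) s) ident
      (fun v => (v ∈ side (m + 3) s false, v ∈ side (m + 3) s true)) T
        ((j : ZMod (m + 3)), p) = F x p := by
    intro j hj p
    rw [abs_le] at hj
    obtain ⟨τ, hτ⟩ := Int.eq_ofNat_of_zero_le (show 0 ≤ j - T by linarith)
    obtain rfl : j = T + τ := by linarith
    exact hout τ (by omega) p
  -- The nine blocks with equal output are `T, …, T + 8`, centered at `T + 4`.
  refine false_of_blocks_alike hS (T + 4) fun j hj p i => ?_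
  have h1 := hout' j hj p
  have h2 := hout' (T + 4) (by simp) p
  exact iff_of_eq (congrArg (i ∈ ·) (h1.trans h2.symm))

/-! ### Conclusion: both bounds in terms of `n` -/

lemma card_le_iterate_of_findsSchedule {s : ℕ} [NeZero s] {ℓ d m T : ℕ} (hd : 1 ≤ d)
    (A : LocalAlgorithm (Prop × Prop) (Set (Fin (ℓ + 1))))
    (hA : FindsSchedule A (Set.range (blockCycleInput s)) d ((m + 3) * (2 * s)) T) :
    (((m + 3) * (2 * s) : ℕ) : ℝ) ≤ (fun y : ℝ => (2 : ℝ) ^ y)^[2 * T + (8 +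
      Fintype.card (Fin 8 → Bool × Fin s → Set (Fin (ℓ + 1))) + 2 * s)] 1 := by
  set q := Fintype.card (Fin 8 → Bool × Fin s → Set (Fin (ℓ + 1)))
  have hm : ((m + 3 : ℕ) : ℝ) ≤ (fun y : ℝ => (2 : ℝ) ^ y)^[2 * T + 8 + q] 1 := by
    -- If the cycle is too short for the argument, then it has at most `2 * T + 8` blocks, and a
    -- tower of that height is larger.
    rcases le_or_gt (2 * T + 9) (m + 3) with hT | hT
    · exact (le_iterate_of_findsSchedule hd A hA hT).trans ((iterate_two_rpow_natCast_le _ _).trans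
        (monotone_iterate_two_rpow_one (by omega)))
    · have h1 : ((m + 3 : ℕ) : ℝ) ≤ (2 * T + 8 : ℕ) := by exact_mod_cast (by omega)
      have h2 := nat_le_iterate_two_rpow (2 * T + 8)
      have h3 := monotone_iterate_two_rpow_one (show 2 * T + 8 ≤ 2 * T + 8 + q by omega)
      dsimp only at h3
      linarith
  have hs : 1 ≤ 2 * s := Nat.mul_pos two_pos (NeZero.pos s)
  calc (((m + 3) * (2 * s) : ℕ) : ℝ) = ((2 * s : ℕ) : ℝ) * ((m + 3 : ℕ) : ℝ) := by
        push_cast; ring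
    _ ≤ ((2 * s : ℕ) : ℝ) * (fun y : ℝ => (2 : ℝ) ^ y)^[2 * T + 8 + q] 1 :=
        mul_le_mul_of_nonneg_left hm (by positivity)
    _ ≤ _ := (mul_iterate_two_rpow_le hs _).trans (iterate_two_rpow_natCast_le _ _)
    _ = _ := by congr 1; omega

theorem theorem3 (k : ℕ) (hk : 2 ≤ k) :
    ∃ 𝒞 : Set ReconfigurationInput,
      (∀ X ∈ 𝒞, X.graph.Connected ∧ ∀ v, (X.graph.neighborSet v).ncard = k) ∧
      (inputSizes 𝒞).Infinite ∧
      -- upper bound, for every sufficiently large constant length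
      (∃ ℓ₀ : ℕ, ∀ ℓ ≥ ℓ₀, ∀ d : ℕ, 1 ≤ d →
        ∃ (A : LocalAlgorithm (Prop × Prop) (Set (Fin (ℓ + 1)))) (C : ℝ),
          ∀ n ∈ inputSizes 𝒞, ∃ T : ℕ,
            (T : ℝ) ≤ C * (logStar (n : ℝ) : ℝ) ∧ FindsSchedule A 𝒞 d n T) ∧
      -- lower bound, for every constant length
      (∀ ℓ d : ℕ, 1 ≤ d →
        ∃ (c : ℝ) (n₀ : ℕ), 0 < c ∧
          ∀ n ∈ inputSizes 𝒞, n₀ ≤ n →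
            ∀ (A : LocalAlgorithm (Prop × Prop) (Set (Fin (ℓ + 1)))) (T : ℕ),
              FindsSchedule A 𝒞 d n T → c * (logStar (n : ℝ) : ℝ) ≤ (T : ℝ)) := by
  obtain ⟨s, rfl⟩ : ∃ s, k = s + 1 := ⟨k - 1, by omega⟩
  have : NeZero s := ⟨by omega⟩
  have hs : 1 ≤ s := by omega
  have hsize : ∀ n ∈ inputSizes (Set.range (blockCycleInput s)), ∃ m, n = (m + 3) * (2 * s) := by
    rintro n ⟨_, ⟨m, rfl⟩, rfl⟩
    exact ⟨m, card_blockCycleInput s m⟩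
  refine ⟨Set.range (blockCycleInput s), ?_, ?_, ?_, ?_⟩
  · rintro _ ⟨m, rfl⟩
    exact ⟨blockCycle.connected (m := m + 3), blockCycle.ncard_neighborSet (by omega)⟩
  · refine Set.infinite_of_injective_forall_mem (f := fun m => (m + 3) * (2 * s)) ?_
      fun m => ⟨_, ⟨m, rfl⟩, card_blockCycleInput s m⟩
    intro a b h
    have := Nat.eq_of_mul_eq_mul_right (by omega) h
    omega
  · obtain ⟨M, hM1, hM⟩ := exists_paletteSize_le_logb (18 * s)
    refine ⟨2 * M, fun ℓ hℓ d _ => ?_⟩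
    obtain ⟨C, hC⟩ := exists_iterate_le_mul_logStar hM1 hM d
    refine ⟨scheduleAlgorithm (18 * s) d ℓ, 4 * C + 1, fun n hn => ?_⟩
    obtain ⟨m, rfl⟩ := hsize n hn
    have hn2 : 2 ≤ (m + 3) * (2 * s) := by nlinarith
    obtain ⟨J, hJ, hJM⟩ := hC _ hn2
    refine ⟨4 * J + 1, ?_, scheduleAlgorithm_findsSchedule s d hJM hℓ⟩
    have hls := one_le_logStar (x := (((m + 3) * (2 * s) : ℕ) : ℝ))
      (by exact_mod_cast (by omega : 1 < (m + 3) * (2 * s)))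
    have hle : 4 * J + 1 ≤ (4 * C + 1) * logStar (((m + 3) * (2 * s) : ℕ) : ℝ) := by
      rw [add_mul, mul_assoc]
      omega
    exact_mod_cast hle
  · intro ℓ d hd
    set K := 8 + Fintype.card (Fin 8 → Bool × Fin s → Set (Fin (ℓ + 1))) + 2 * s
    -- Beyond the tower of height `K`, zero rounds are impossible, so `T ≥ 1` and the additive
    -- constant `K` is absorbed: `2 * T + K ≤ T * (2 + K)`.
    obtain ⟨n₀, hn₀⟩ := exists_nat_gt ((fun y : ℝ => (2 : ℝ) ^ y)^[K] 1)
    refine ⟨1 / (2 + K), n₀, by positivity, fun n hn hle A T hA => ?_⟩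
    obtain ⟨m, rfl⟩ := hsize n hn
    have hub := card_le_iterate_of_findsSchedule hd A hA
    have hT : 1 ≤ T := by
      by_contra h
      obtain rfl : T = 0 := by omega
      rw [mul_zero, zero_add] at hub
      have : ((n₀ : ℕ) : ℝ) ≤ (((m + 3) * (2 * s) : ℕ) : ℝ) := by exact_mod_cast hle
      linarith
    have hls := logStar_le_of_le_iterate hub
    have hls' : logStar (((m + 3) * (2 * s) : ℕ) : ℝ) ≤ T * (2 + K) := by
      change _ ≤ 2 * T + K at hls
      have := Nat.le_mul_of_pos_left K hT
      rw [mul_add]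
      omega
    rw [one_div_mul_eq_div, div_le_iff₀ (by positivity)]
    exact_mod_cast hls'
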